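/- \textbf{Theorem 5.} Let $M\ge 2$ (number of users) and $N_0\ge 1$ (code length) be integers and let $\beta=\frac{M-1}{MN_0}$. The coherent optical CDMA channel is the memoryless channel with input $X\ge 0$ and output $Y\in\{0,1,2,\dots\}$ whose transition law, when the input has mean $\eta=\mathbb E[X]>0$, is the Laguerre law $$W(y|x)=\frac{e^{-\frac{x}{M\beta\eta}}}{1+\beta\eta}\left(\frac{\beta\eta}{1+\beta\eta}\right)^{y}\sum_{j=0}^{\infty}\left(\frac{x}{M\beta\eta(1+\beta\eta)}\right)^{j}\frac{(y+j)!}{(j!)^2\,y!}$$ (so the average noise power $\beta\eta$ depends on the average input power; if $\eta=0$, then $X=0$ and $Y=0$ almost surely). For $\mathcal E>0$ let $$\mathcal C(\mathcal E)=\sup_Q I(X;Y)$$ be its capacity in nats under an average-power constraint only, where the supremum is over all laws $Q$ of a nonnegative random variable $X$ with $\mathbb E[X]\le\mathcal E$. Then, with $\log$ the natural logarithm, $$\begin{aligned}\mathcal C(\mathcal E)\ \ge\ &\tfrac12\log\mathcal E-\sqrt{\frac{M\pi\left(12\beta\mathcal E(\beta\mathcal E+1)+1\right)}{24\,\mathcal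 E\,(2\beta\mathcal E+1)}}-1+\left(\frac{\mathcal E}{M}+\beta\mathcal E\right)\log\left(1+\frac{1}{\frac{\mathcal E}{M}+\beta\mathcal E}\right)\\&+\log\left(\frac1M+\frac{1+\beta\mathcal E}{\mathcal E}\right)-\frac12\log\left(\frac{2\beta\mathcal E+1}{M}\right).\end{aligned}$$ -/

import Mathlib

open MeasureTheory
open scoped ENNReal Nat

noncomputable section

namespace CoherentCDMA

/-- Noise factor `β = (M - 1) / (M N₀)` of a coherent optical CDMA network with `M` users and
codes of length `N₀`. -/
def noiseFactor (M N₀ : ℕ) : ℝ := ((M : ℝ) - 1) / ((M : ℝ) * (N₀ : ℝ))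

/-- Channel law `W(y|x)` of the coherent optical CDMA channel with `M` users and noise factor `β`,
when the average power of the input is `η`: Laguerre, with average noise power `β η`. -/
def channelLaw (M : ℕ) (β η x : ℝ) (y : ℕ) : ℝ :=
  Real.exp (-x / ((M : ℝ) * (β * η))) / (1 + β * η) * (β * η / (1 + β * η)) ^ y *
    ∑' j : ℕ, (x / ((M : ℝ) * (β * η) * (1 + β * η))) ^ j *
      (((y + j)! : ℝ) / ((j ! : ℝ) ^ 2 * (y ! : ℝ)))

/-- Mean (average power) of the law `Q` of an input. -/
def avgPower (Q : Measure ℝ) : ℝ := ∫ x, x ∂Q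

/-- `Q` is the law of a nonnegative random variable `X` with `E[X] ≤ ℰ`. -/
structure IsAdmissible (ℰ : ℝ) (Q : Measure ℝ) : Prop where
  isProbabilityMeasure : IsProbabilityMeasure Q
  nonneg : ∀ᵐ x ∂Q, 0 ≤ x
  integrable : Integrable (fun x : ℝ => x) Q
  avgPower_le : avgPower Q ≤ ℰ

/-- Joint law `Q(dx) W(y|x)` of input and output when the input has law `Q`. The noise depends on
the input law, through its average power. -/
def jointLaw (M : ℕ) (β : ℝ) (Q : Measure ℝ) : Measure (ℝ × ℕ) :=
  (Q.prod Measure.count).withDensity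
    fun p => ENNReal.ofReal (channelLaw M β (avgPower Q) p.1 p.2)

/-- Mutual information (in nats) of a pair of random variables with joint law `P`: the
Kullback-Leibler divergence of `P` from the product of its marginals. -/
def mutualInfo {α γ : Type*} [MeasurableSpace α] [MeasurableSpace γ] (P : Measure (α × γ)) :
    ℝ≥0∞ :=
  InformationTheory.klDiv P ((P.map Prod.fst).prod (P.map Prod.snd))

/-- Capacity (in nats per channel use) under the average-power constraint `ℰ` alone: the supremum
of `I(X;Y)` over all laws of a nonnegative input `X` with `E[X] ≤ ℰ`. -/
def capacity (M : ℕ) (β ℰ : ℝ) : ℝ≥0∞ :=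
  ⨆ Q ∈ {Q : Measure ℝ | IsAdmissible ℰ Q}, mutualInfo (jointLaw M β Q)

end CoherentCDMA

end

/-!
# A lower bound on the capacity of the coherent optical CDMA channel

Write `N = β ℰ` for the noise power and `μ = ℰ / M + N` for the output power. The input is taken
gamma distributed with shape `1 / 2` and mean `ℰ`; call its density `q`. In the notation of
entropies, `I(X;Y) = H(Y) - H(Y|X)`, and each term has a bound of its own.

* `H(Y|X = x)` is at most the cross entropy of `W(·|x)` with the discretized Gaussian law whose
  variance `v x` is that of `W(·|x)` plus `1 / 12`, so at most `1 / 2 * log (2 π e (v x))`.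
* An exponential input of mean `ℰ` produces a geometric output of mean `μ`. By data processing, the
  divergence of the actual output from that geometric law is at most the divergence of `q` from the
  exponential density, which gives `H(Y) ≥ h(X) - log ℰ - 1 + μ log (1 + 1 / μ) + log (1 + μ)`.

For the gamma density, `h(X)` is the mean of `1 / 2 * log (2 π ℰ X)` plus `1 / 2`, and `v x` is a
multiple of `x + a` for a constant `a`. All that remains is the mean of `1 / 2 * log (1 + a / X)`,
at most `√(π a / (2 ℰ))` by an explicit integral (`integral_log_gammaMeasure_le`).

Both bounds are Gibbs inequalities, and their sum no longer involves the output law. They are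
therefore applied together and pointwise to the log-likelihood ratio
(`ofReal_integral_le_mutualInfo`), so that no entropy of the output or of the input has to be shown
finite. The moments of `W(·|x)` and its exponential mixture come from writing the Laguerre law as a
Poisson mixture of negative binomial laws (`channelLaw_eq_tsum`); that the discretized Gaussian has
total mass at most one is `tsum_gaussianCell_le_one`.
-/

noncomputable section

namespace CoherentCDMA

/-! ### A lower bound on mutual information -/

/-- Joint law of input and output for an input law `Q` and a discrete channel with probability
mass functions `W x`. -/
def channelJoint {α : Type*} [MeasurableSpace α] (Q : Measure α) (W : α → ℕ → ℝ) :
    Measure (α × ℕ) :=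
  (Q.prod Measure.count).withDensity fun p => ENNReal.ofReal (W p.1 p.2)

section Channel

variable {α : Type*} [MeasurableSpace α] {Q : Measure α} {W : α → ℕ → ℝ}

lemma measurable_ofReal_uncurry (hW : ∀ y, Measurable fun x => W x y) :
    Measurable fun p : α × ℕ => ENNReal.ofReal (W p.1 p.2) :=
  measurable_from_prod_countable_left fun y => (hW y).ennreal_ofReal

lemma lintegral_channelJoint (hW : ∀ y, Measurable fun x => W x y) {k : α → ℕ → ℝ≥0∞}
    (hk : ∀ y, Measurable fun x => k x y) :
    ∫⁻ p, k p.1 p.2 ∂(channelJoint Q W) = ∫⁻ x, ∑' y, ENNReal.ofReal (W x y) * k x y ∂Q := by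
  have hk' : Measurable fun p : α × ℕ => k p.1 p.2 := measurable_from_prod_countable_left hk
  rw [channelJoint, lintegral_withDensity_eq_lintegral_mul _ (measurable_ofReal_uncurry hW) hk',
    lintegral_prod _ ((measurable_ofReal_uncurry hW).mul hk').aemeasurable]
  simp [lintegral_count]

lemma ae_channelJoint {P : α → Prop} (hP : ∀ᵐ x ∂Q, P x) :
    ∀ᵐ p ∂(channelJoint Q W), P p.1 :=
  (withDensity_absolutelyContinuous _ _).ae_le
    (Measure.quasiMeasurePreserving_fst.ae hP)

lemma tsum_ofReal_eq_one (h0 : ∀ᵐ x ∂Q, ∀ y, 0 < W x y) (h1 : ∀ᵐ x ∂Q, HasSum (W x) 1) :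
    ∀ᵐ x ∂Q, ∑' y, ENNReal.ofReal (W x y) = 1 := by
  filter_upwards [h0, h1] with x h0 h1
  rw [← ENNReal.ofReal_tsum_of_nonneg (fun y => (h0 y).le) h1.summable, h1.tsum_eq,
    ENNReal.ofReal_one]

lemma map_fst_channelJoint (hW : ∀ y, Measurable fun x => W x y)
    (h0 : ∀ᵐ x ∂Q, ∀ y, 0 < W x y) (h1 : ∀ᵐ x ∂Q, HasSum (W x) 1) :
    (channelJoint Q W).map Prod.fst = Q := by
  refine Measure.ext_of_lintegral _ fun f hf => ?_
  rw [lintegral_map hf measurable_fst,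
    lintegral_channelJoint hW (k := fun x _ => f x) fun _ => hf]
  refine lintegral_congr_ae ?_
  filter_upwards [tsum_ofReal_eq_one h0 h1] with x hx
  rw [ENNReal.tsum_mul_right, hx, one_mul]

lemma isProbabilityMeasure_channelJoint [IsProbabilityMeasure Q]
    (hW : ∀ y, Measurable fun x => W x y)
    (h0 : ∀ᵐ x ∂Q, ∀ y, 0 < W x y) (h1 : ∀ᵐ x ∂Q, HasSum (W x) 1) :
    IsProbabilityMeasure (channelJoint Q W) := by
  constructor
  have := map_fst_channelJoint hW h0 h1
  rw [← Set.preimage_univ (f := Prod.fst), ← Measure.map_apply measurable_fst MeasurableSet.univ,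
    this, measure_univ]

lemma map_snd_channelJoint (hW : ∀ y, Measurable fun x => W x y) :
    (channelJoint Q W).map Prod.snd =
      Measure.count.withDensity fun y => ∫⁻ x, ENNReal.ofReal (W x y) ∂Q := by
  refine Measure.ext_of_lintegral _ fun f hf => ?_
  rw [lintegral_map hf measurable_snd,
    lintegral_channelJoint hW (k := fun _ y => f y) fun _ => measurable_const,
    lintegral_withDensity_eq_lintegral_mul _ (measurable_of_countable _) hf, lintegral_count,
    lintegral_tsum fun y => ((hW y).ennreal_ofReal.mul_const _).aemeasurable]
  simp only [Pi.mul_apply]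
  exact tsum_congr fun y => lintegral_mul_const _ (hW y).ennreal_ofReal

/-- Integration against the joint law of a nonnegative function whose conditional expectations
given the input are known. -/
lemma integral_channelJoint_of_nonneg (hW : ∀ y, Measurable fun x => W x y)
    (h0 : ∀ᵐ x ∂Q, ∀ y, 0 < W x y) {k : α → ℕ → ℝ} (hk : ∀ y, Measurable fun x => k x y)
    (hk0 : ∀ᵐ x ∂Q, ∀ y, 0 ≤ k x y) {K : α → ℝ} (hK : Integrable K Q)
    (hkK : ∀ᵐ x ∂Q, HasSum (fun y => W x y * k x y) (K x)) :
    Integrable (fun p => k p.1 p.2) (channelJoint Q W) ∧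
      ∫ p, k p.1 p.2 ∂(channelJoint Q W) = ∫ x, K x ∂Q := by
  have hm : Measurable fun p : α × ℕ => k p.1 p.2 := measurable_from_prod_countable_left hk
  have hae : 0 ≤ᵐ[channelJoint Q W] fun p => k p.1 p.2 := by
    filter_upwards [ae_channelJoint (W := W) hk0] with p hp using hp p.2
  have hK0 : 0 ≤ᵐ[Q] K := by
    filter_upwards [h0, hk0, hkK] with x h0 h1 h2
    exact h2.nonneg fun y => mul_nonneg (h0 y).le (h1 y)
  have hl : ∫⁻ p, ENNReal.ofReal (k p.1 p.2) ∂(channelJoint Q W)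
      = ∫⁻ x, ENNReal.ofReal (K x) ∂Q := by
    rw [lintegral_channelJoint hW (k := fun x y => ENNReal.ofReal (k x y))
      fun y => (hk y).ennreal_ofReal]
    refine lintegral_congr_ae ?_
    filter_upwards [h0, hk0, hkK] with x h0 h1 h2
    rw [← h2.tsum_eq, ENNReal.ofReal_tsum_of_nonneg
      (fun y => mul_nonneg (h0 y).le (h1 y)) h2.summable]
    exact tsum_congr fun y => (ENNReal.ofReal_mul (h0 y).le).symm
  refine ⟨?_, ?_⟩
  · rw [← lintegral_ofReal_ne_top_iff_integrable hm.aestronglyMeasurable hae, hl,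
      lintegral_ofReal_ne_top_iff_integrable hK.1 hK0]
    exact hK
  · rw [integral_eq_lintegral_of_nonneg_ae hae hm.aestronglyMeasurable, hl,
      integral_eq_lintegral_of_nonneg_ae hK0 hK.1]

lemma integrable_and_integral_le_of_lintegral_le {γ : Type*} [MeasurableSpace γ] {P : Measure γ}
    {f : γ → ℝ} {c : ℝ} (hf : Measurable f) (h0 : 0 ≤ᵐ[P] f) (hc : 0 ≤ c)
    (h1 : ∫⁻ p, ENNReal.ofReal (f p) ∂P ≤ ENNReal.ofReal c) :
    Integrable f P ∧ ∫ p, f p ∂P ≤ c := by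
  refine ⟨?_, ?_⟩
  · rw [← lintegral_ofReal_ne_top_iff_integrable hf.aestronglyMeasurable h0]
    exact ne_top_of_le_ne_top ENNReal.ofReal_ne_top h1
  · rw [integral_eq_lintegral_of_nonneg_ae h0 hf.aestronglyMeasurable]
    exact ENNReal.toReal_le_of_le_ofReal hc h1

/-- Lower bound on the mutual information of a discrete channel. It adds two Gibbs inequalities:
the entropy of `W x` is at most its cross entropy with the subprobability `g x`, and the posterior
law of the input given the output has nonnegative divergence from the subprobability of density
`h x * W x y / R y` with respect to `Q`. The output probabilities cancel from the sum. -/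
theorem ofReal_integral_le_mutualInfo [IsProbabilityMeasure Q]
    (hW : ∀ y, Measurable fun x => W x y)
    (h0 : ∀ᵐ x ∂Q, ∀ y, 0 < W x y) (h1 : ∀ᵐ x ∂Q, HasSum (W x) 1)
    {g : α → ℕ → ℝ} (hg : ∀ y, Measurable fun x => g x y) (hg0 : ∀ᵐ x ∂Q, ∀ y, 0 < g x y)
    (hg1 : ∀ᵐ x ∂Q, ∑' y, ENNReal.ofReal (g x y) ≤ 1)
    {h : α → ℝ} (hh : Measurable h) (hh0 : ∀ᵐ x ∂Q, 0 < h x)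
    {R : ℕ → ℝ} (hR : ∀ y, 0 < R y)
    (hhR : ∀ y, ∫⁻ x, ENNReal.ofReal (h x * W x y) ∂Q ≤ ENNReal.ofReal (R y))
    (hf : Integrable (fun p => Real.log (g p.1 p.2) + Real.log (h p.1) - Real.log (R p.2))
      (channelJoint Q W)) :
    ENNReal.ofReal (∫ p, (Real.log (g p.1 p.2) + Real.log (h p.1) - Real.log (R p.2))
      ∂(channelJoint Q W)) ≤ mutualInfo (channelJoint Q W) := by
  have hP1 := isProbabilityMeasure_channelJoint hW h0 h1
  set P := channelJoint Q W with hP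
  set w : α × ℕ → ℝ≥0∞ := fun p => ENNReal.ofReal (W p.1 p.2) with hw
  have hwm : Measurable w := measurable_ofReal_uncurry hW
  set p : ℕ → ℝ≥0∞ := fun y => ∫⁻ x, ENNReal.ofReal (W x y) ∂Q with hp
  have hpm : Measurable p := measurable_of_countable _
  have hpsum : ∑' y, p y = 1 := by
    rw [hp, ← lintegral_tsum fun y => (hW y).ennreal_ofReal.aemeasurable,
      lintegral_congr_ae (tsum_ofReal_eq_one h0 h1)]
    simp
  have hptop : ∀ y, p y ≠ ∞ := fun y =>
    ne_top_of_le_ne_top ENNReal.one_ne_top (hpsum ▸ ENNReal.le_tsum y)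
  have hppos : ∀ y, p y ≠ 0 := by
    intro y hy
    rw [hp, lintegral_eq_zero_iff (hW y).ennreal_ofReal] at hy
    have : ∀ᵐ x ∂Q, False := by
      filter_upwards [h0, hy] with x h0 hx
      simp only [Pi.zero_apply, ENNReal.ofReal_eq_zero] at hx
      exact absurd (h0 y) (not_lt.2 hx)
    simp at this
    exact IsProbabilityMeasure.ne_zero Q this
  have hfst : P.map Prod.fst = Q := map_fst_channelJoint hW h0 h1
  have hsnd : P.map Prod.snd = Measure.count.withDensity p := map_snd_channelJoint hW
  have hPY : IsProbabilityMeasure (P.map Prod.snd) :=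
    Measure.isProbabilityMeasure_map measurable_snd.aemeasurable
  set ν := Q.prod (P.map Prod.snd) with hν
  have hν' : ν = (Q.prod Measure.count).withDensity fun q => p q.2 := by
    rw [hν, hsnd]
    have : SFinite (Measure.count.withDensity p) := hsnd ▸ inferInstance
    exact prod_withDensity_right hpm
  -- The density of the joint law with respect to the product of the marginals is `W / p`.
  have hPν : P = ν.withDensity fun q => w q / p q.2 := by
    have e := withDensity_mul (Q.prod Measure.count) (hpm.comp measurable_snd)
      (hwm.div (hpm.comp measurable_snd))
    refine Eq.trans ?_ (e.trans (by rw [hν']; rfl))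
    rw [hP, channelJoint]
    congr 1
    ext q
    exact (ENNReal.mul_div_cancel (hppos _) (hptop _)).symm
  have hac : P ≪ ν := hPν ▸ withDensity_absolutelyContinuous _ _
  rw [mutualInfo, hfst, ← hν]
  by_cases hi : Integrable (llr P ν) P
  swap
  · rw [InformationTheory.klDiv_of_not_integrable hi]
    exact le_top
  rw [InformationTheory.klDiv_of_ac_of_integrable hac hi]
  refine ENNReal.ofReal_le_ofReal ?_
  have hrn : ∀ᵐ q ∂P, P.rnDeriv ν q = w q / p q.2 := by
    refine hac.ae_le ?_
    nth_rewrite 1 [hPν]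
    exact Measure.rnDeriv_withDensity ν (hwm.div (hpm.comp measurable_snd))
  -- The two error terms have integral at most one against the joint law.
  set A : α × ℕ → ℝ := fun q => g q.1 q.2 / W q.1 q.2 with hA
  set B : α × ℕ → ℝ := fun q => h q.1 * ((p q.2).toReal / R q.2) with hB
  have hAm : ∀ y, Measurable fun x => A (x, y) := fun y => (hg y).div (hW y)
  have hBm : ∀ y, Measurable fun x => B (x, y) := fun y => hh.mul_const ((p y).toReal / R y)
  obtain ⟨hAi, hA1⟩ : Integrable A P ∧ ∫ q, A q ∂P ≤ 1 := by
    refine integrable_and_integral_le_of_lintegral_le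
      (measurable_from_prod_countable_left hAm) ?_ zero_le_one ?_
    · filter_upwards [ae_channelJoint (W := W) h0, ae_channelJoint (W := W) hg0] with q h1 h2
      exact (div_pos (h2 _) (h1 _)).le
    · rw [ENNReal.ofReal_one]
      calc ∫⁻ q, ENNReal.ofReal (A q) ∂P
          = ∫⁻ x, ∑' y, ENNReal.ofReal (W x y) * ENNReal.ofReal (A (x, y)) ∂Q :=
            lintegral_channelJoint hW (k := fun x y => ENNReal.ofReal (A (x, y)))
              fun y => (hAm y).ennreal_ofReal
        _ ≤ ∫⁻ _, 1 ∂Q := by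
            refine lintegral_mono_ae ?_
            filter_upwards [h0, hg1] with x h0 h1
            refine le_trans (le_of_eq (tsum_congr fun y => ?_)) h1
            rw [← ENNReal.ofReal_mul (h0 y).le, hA, mul_div_cancel₀ _ (h0 y).ne']
        _ = 1 := by simp
  obtain ⟨hBi, hB1⟩ : Integrable B P ∧ ∫ q, B q ∂P ≤ 1 := by
    refine integrable_and_integral_le_of_lintegral_le
      (measurable_from_prod_countable_left hBm) ?_ zero_le_one ?_
    · filter_upwards [ae_channelJoint (W := W) hh0] with q h1
      exact mul_nonneg h1.le (div_nonneg ENNReal.toReal_nonneg (hR _).le)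
    · rw [ENNReal.ofReal_one]
      calc ∫⁻ q, ENNReal.ofReal (B q) ∂P
          = ∫⁻ x, ∑' y, ENNReal.ofReal (W x y) * ENNReal.ofReal (B (x, y)) ∂Q :=
            lintegral_channelJoint hW (k := fun x y => ENNReal.ofReal (B (x, y)))
              fun y => (hBm y).ennreal_ofReal
        _ = ∑' y, ∫⁻ x, ENNReal.ofReal (W x y) * ENNReal.ofReal (B (x, y)) ∂Q :=
            lintegral_tsum fun y =>
              ((hW y).ennreal_ofReal.mul (hBm y).ennreal_ofReal).aemeasurable
        _ ≤ ∑' y, p y := by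
            refine ENNReal.tsum_le_tsum fun y => ?_
            have e : ∀ᵐ x ∂Q, ENNReal.ofReal (W x y) * ENNReal.ofReal (B (x, y))
                = ENNReal.ofReal (h x * W x y) * ENNReal.ofReal ((p y).toReal / R y) := by
              filter_upwards [h0, hh0] with x h0 h1
              rw [← ENNReal.ofReal_mul (h0 y).le,
                ← ENNReal.ofReal_mul (mul_nonneg h1.le (h0 y).le), hB]
              congr 1
              ring
            have hm : Measurable fun x => h x * W x y := hh.mul (hW y)
            rw [lintegral_congr_ae e, lintegral_mul_const _ hm.ennreal_ofReal]
            calc _ ≤ ENNReal.ofReal (R y) * ENNReal.ofReal ((p y).toReal / R y) := by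
                  gcongr
                  exact hhR y
              _ = p y := by
                  rw [← ENNReal.ofReal_mul (hR y).le, mul_div_cancel₀ _ (hR y).ne',
                    ENNReal.ofReal_toReal (hptop y)]
        _ = 1 := hpsum
  set f : α × ℕ → ℝ :=
    fun p => Real.log (g p.1 p.2) + Real.log (h p.1) - Real.log (R p.2) with hfdef
  have hle : ∀ᵐ q ∂P, f q + 2 - A q - B q ≤ llr P ν q := by
    filter_upwards [hrn, ae_channelJoint (W := W) h0, ae_channelJoint (W := W) hg0,
      ae_channelJoint (W := W) hh0] with q hr hW0 hg0 hh0
    have hWq := hW0 q.2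
    have hgq := hg0 q.2
    have hpq : 0 < (p q.2).toReal := ENNReal.toReal_pos (hppos _) (hptop _)
    have hRq := hR q.2
    rw [llr, hr, ENNReal.toReal_div, ENNReal.toReal_ofReal hWq.le]
    have hA0 : 0 < A q := div_pos hgq hWq
    have hB0 : 0 < B q := mul_pos hh0 (div_pos hpq hRq)
    -- `log (W / p) = f - log A - log B`, and `log t ≤ t - 1` is used for both `A` and `B`.
    have e1 := Real.log_le_sub_one_of_pos hA0
    have e2 := Real.log_le_sub_one_of_pos hB0
    have e3 : Real.log (A q) = Real.log (g q.1 q.2) - Real.log (W q.1 q.2) :=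
      Real.log_div hgq.ne' hWq.ne'
    have e4 : Real.log (B q) = Real.log (h q.1)
        + (Real.log (p q.2).toReal - Real.log (R q.2)) := by
      rw [hB, Real.log_mul hh0.ne' (div_pos hpq hRq).ne', Real.log_div hpq.ne' hRq.ne']
    have e5 : Real.log (W q.1 q.2 / (p q.2).toReal)
        = Real.log (W q.1 q.2) - Real.log (p q.2).toReal := Real.log_div hWq.ne' hpq.ne'
    rw [e5]
    simp only [hfdef]
    linarith
  have h2 : Integrable (fun q => f q + 2) P := hf.add (integrable_const 2)
  have hint := integral_mono_ae ((h2.sub hAi).sub hBi) hi hle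
  have e : ∫ q, ((fun q => f q + 2) - A - B) q ∂P = ∫ q, f q ∂P + 2 - ∫ q, A q ∂P - ∫ q, B q ∂P := by
    rw [integral_sub' (h2.sub hAi) hBi, integral_sub' h2 hAi,
      integral_add hf (integrable_const 2)]
    simp
  rw [e] at hint
  have hν1 : IsProbabilityMeasure ν := by rw [hν]; infer_instance
  simp only [probReal_univ]
  linarith

end Channel

/-! ### The Laguerre law as a Poisson mixture of negative binomial laws -/

/-- Poisson weights of parameter `l`. -/
def poissonWeight (l : ℝ) (j : ℕ) : ℝ := Real.exp (-l) * (l ^ j / j !)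

/-- Negative binomial weights: the number of noise counts in `j + 1` thermal modes, each of mean
`N`. -/
def negBinWeight (N : ℝ) (j y : ℕ) : ℝ :=
  ((y + j).choose j : ℝ) * (1 / (1 + N)) ^ (j + 1) * (N / (1 + N)) ^ y

lemma negBinWeight_pos {N : ℝ} (hN : 0 < N) (j y : ℕ) : 0 < negBinWeight N j y := by
  have : 0 < (y + j).choose j := Nat.choose_pos (Nat.le_add_left _ _)
  unfold negBinWeight
  positivity

lemma poissonWeight_nonneg {l : ℝ} (hl : 0 ≤ l) (j : ℕ) : 0 ≤ poissonWeight l j := by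
  unfold poissonWeight
  positivity

lemma cast_descFactorial_add (z k : ℕ) :
    ((z + k).descFactorial k : ℝ) = ((z + k)! : ℝ) / z ! := by
  rw [eq_div_iff (by positivity), mul_comm]
  have := Nat.factorial_mul_descFactorial (Nat.le_add_left k z)
  rw [Nat.add_sub_cancel] at this
  exact_mod_cast this

/-- The factorial moment of order `k` of the negative binomial law. -/
lemma hasSum_descFactorial_mul_negBinWeight {N : ℝ} (hN : 0 < N) (k j : ℕ) :
    HasSum (fun y => (y.descFactorial k : ℝ) * negBinWeight N j y)
      (((j + k)! : ℝ) / j ! * N ^ k) := by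
  have hr : ‖N / (1 + N)‖ < 1 := by
    rw [Real.norm_of_nonneg (by positivity), div_lt_one (by positivity)]
    linarith
  -- The terms `y < k` vanish, and `y = z + k` turns the rest into a binomial series of order
  -- `j + k`.
  have hinj : Function.Injective fun z : ℕ => z + k := add_left_injective k
  rw [← hinj.hasSum_iff]
  · have h := (hasSum_choose_mul_geometric_of_norm_lt_one (j + k) hr).mul_left
      (((j + k)! : ℝ) / j ! * (1 / (1 + N)) ^ (j + 1) * (N / (1 + N)) ^ k)
    convert! h using 1
    · ext z
      have e2 : (((z + k + j).choose j : ℕ) : ℝ) = ((z + k + j)! : ℝ) / ((z + k)! * j !) := by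
        rw [add_comm (z + k) j, Nat.cast_add_choose, mul_comm (j ! : ℝ)]
      have e3 : (((z + (j + k)).choose (j + k) : ℕ) : ℝ)
          = ((z + k + j)! : ℝ) / (z ! * (j + k)!) := by
        rw [add_comm z (j + k), Nat.cast_add_choose, mul_comm ((j + k)! : ℝ)]
        congr 3
        ring
      simp only [Function.comp_apply, negBinWeight]
      rw [cast_descFactorial_add z k, e2, e3, pow_add _ z k]
      have : ((z + k)! : ℝ) ≠ 0 := by positivity
      have : ((j + k)! : ℝ) ≠ 0 := by positivity
      have : (z ! : ℝ) ≠ 0 := by positivity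
      have : (j ! : ℝ) ≠ 0 := by positivity
      generalize (1 / (1 + N)) ^ (j + 1) = a
      generalize (N / (1 + N)) ^ z = b
      generalize (N / (1 + N)) ^ k = c
      field_simp
    · have : 1 - N / (1 + N) = 1 / (1 + N) := by field_simp; ring
      rw [this]
      simp only [div_pow, one_pow]
      have : (1 + N) ≠ 0 := by positivity
      have : (j ! : ℝ) ≠ 0 := by positivity
      field_simp
      ring
  · intro y hy
    have : y < k := by
      by_contra! h
      exact hy ⟨y - k, Nat.sub_add_cancel h⟩
    simp [Nat.descFactorial_of_lt this]

/-- The factorial moment of order `k` of the Poisson law. -/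
lemma hasSum_descFactorial_mul_poissonWeight (l : ℝ) (k : ℕ) :
    HasSum (fun j => (j.descFactorial k : ℝ) * poissonWeight l j) (l ^ k) := by
  have hinj : Function.Injective fun z : ℕ => z + k := add_left_injective k
  rw [← hinj.hasSum_iff]
  · have h := (NormedSpace.expSeries_div_hasSum_exp (𝔸 := ℝ) l).mul_left (Real.exp (-l) * l ^ k)
    rw [← congr_fun Real.exp_eq_exp_ℝ l, mul_right_comm, ← Real.exp_add, neg_add_cancel,
      Real.exp_zero, one_mul] at h
    convert! h using 1
    ext z
    have : (z ! : ℝ) ≠ 0 := by positivity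
    have : ((z + k)! : ℝ) ≠ 0 := by positivity
    simp only [Function.comp_apply, poissonWeight]
    rw [cast_descFactorial_add z k, pow_add]
    field_simp
  · intro y hy
    have : y < k := by
      by_contra! h
      exact hy ⟨y - k, Nat.sub_add_cancel h⟩
    simp [Nat.descFactorial_of_lt this]

/-- Tonelli for double series of nonnegative reals. -/
lemma hasSum_tsum_swap {F : ℕ → ℕ → ℝ} (hF : ∀ j y, 0 ≤ F j y) {a : ℕ → ℝ} {A : ℝ}
    (ha : ∀ j, HasSum (F j) (a j)) (hA : HasSum a A) :
    (∀ y, Summable fun j => F j y) ∧ HasSum (fun y => ∑' j, F j y) A := by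
  have hs : Summable fun p : ℕ × ℕ => F p.1 p.2 := by
    rw [summable_prod_of_nonneg fun p => hF _ _]
    refine ⟨fun j => (ha j).summable, ?_⟩
    simpa only [(ha _).tsum_eq] using hA.summable
  have ht : ∑' p : ℕ × ℕ, F p.1 p.2 = A :=
    (hs.hasSum.prod_fiberwise ha).unique hA
  have hs' : HasSum (fun p : ℕ × ℕ => F p.2 p.1) A := by
    rw [← ht]
    exact (Equiv.prodComm ℕ ℕ).hasSum_iff.2 hs.hasSum
  have hy : ∀ y, Summable fun j => F j y := fun y => hs'.summable.prod_factor y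
  exact ⟨hy, hs'.prod_fiberwise fun y => (hy y).hasSum⟩

/-- The Laguerre law is a Poisson mixture of negative binomial laws. -/
lemma channelLaw_eq_tsum (M : ℕ) (β η x : ℝ) (y : ℕ) :
    channelLaw M β η x y =
      ∑' j, poissonWeight (x / (M * (β * η))) j * negBinWeight (β * η) j y := by
  rw [channelLaw, ← tsum_mul_left]
  refine tsum_congr fun j => ?_
  have e : (((y + j).choose j : ℕ) : ℝ) = ((y + j)! : ℝ) / (y ! * j !) := by
    rw [add_comm y j, Nat.cast_add_choose, mul_comm (j ! : ℝ)]
  rw [poissonWeight, negBinWeight, e, ← div_div x, div_pow (x / _), pow_succ (1 / _),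
    one_div, inv_pow, neg_div]
  generalize x / (M * (β * η)) = l
  generalize (β * η / (1 + β * η)) ^ y = b
  have : (y ! : ℝ) ≠ 0 := by positivity
  have : (j ! : ℝ) ≠ 0 := by positivity
  field_simp

lemma measurable_channelLaw (M : ℕ) (β η : ℝ) (y : ℕ) :
    Measurable fun x => channelLaw M β η x y := by
  simp only [channelLaw_eq_tsum, poissonWeight]
  exact Measurable.tsum fun j => by fun_prop

section Moments

variable {M : ℕ} {β η x : ℝ}

/-- The factorial moments of the output, in terms of those of the Poisson mixing law. -/
lemma hasSum_descFactorial_mul_channelLaw (hN : 0 < β * η) (hx : 0 ≤ x) (k : ℕ) {A : ℝ}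
    (hA : HasSum (fun j => poissonWeight (x / (M * (β * η))) j * (((j + k)! : ℝ) / j !)) A) :
    (∀ y, Summable fun j => (y.descFactorial k : ℝ) *
        (poissonWeight (x / (M * (β * η))) j * negBinWeight (β * η) j y)) ∧
      HasSum (fun y => (y.descFactorial k : ℝ) * channelLaw M β η x y) ((β * η) ^ k * A) := by
  have hl : 0 ≤ x / (M * (β * η)) := by positivity
  have := hasSum_tsum_swap (F := fun j y => (y.descFactorial k : ℝ) *
        (poissonWeight (x / (M * (β * η))) j * negBinWeight (β * η) j y))
    (a := fun j => (β * η) ^ k * (poissonWeight (x / (M * (β * η))) j * (((j + k)! : ℝ) / j !)))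
    (fun j y => mul_nonneg (Nat.cast_nonneg _)
      (mul_nonneg (poissonWeight_nonneg hl j) (negBinWeight_pos hN j y).le))
    (fun j => by
      have h := (hasSum_descFactorial_mul_negBinWeight hN k j).mul_left
        (poissonWeight (x / (M * (β * η))) j)
      convert! h using 1
      · ext y
        exact mul_left_comm _ _ _
      · rw [mul_left_comm, mul_comm _ ((β * η) ^ k), mul_left_comm]) (hA.mul_left _)
  simpa only [tsum_mul_left, ← channelLaw_eq_tsum] using this

lemma hasSum_poissonWeight_zero (l : ℝ) :
    HasSum (fun j => poissonWeight l j * (((j + 0)! : ℝ) / j !)) 1 := by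
  convert! hasSum_descFactorial_mul_poissonWeight l 0 using 1
  ext j
  have : (j ! : ℝ) ≠ 0 := by positivity
  simp [this]

lemma hasSum_channelLaw (hN : 0 < β * η) (hx : 0 ≤ x) :
    HasSum (channelLaw M β η x) 1 := by
  simpa using (hasSum_descFactorial_mul_channelLaw (M := M) hN hx 0
    (hasSum_poissonWeight_zero _)).2

lemma channelLaw_pos (hN : 0 < β * η) (hx : 0 ≤ x) (y : ℕ) : 0 < channelLaw M β η x y := by
  have hl : 0 ≤ x / (M * (β * η)) := by positivity
  have hs := (hasSum_descFactorial_mul_channelLaw (M := M) hN hx 0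
    (hasSum_poissonWeight_zero _)).1 y
  simp only [Nat.descFactorial_zero, Nat.cast_one, one_mul] at hs
  rw [channelLaw_eq_tsum]
  refine hs.tsum_pos (fun j => mul_nonneg (poissonWeight_nonneg hl j)
    (negBinWeight_pos hN j y).le) 0 (mul_pos ?_ (negBinWeight_pos hN 0 y))
  simp [poissonWeight, Real.exp_pos]

/-- The conditional mean of the output. -/
lemma hasSum_mul_channelLaw (hM : (M : ℝ) ≠ 0) (hN : 0 < β * η) (hx : 0 ≤ x) :
    HasSum (fun y : ℕ => (y : ℝ) * channelLaw M β η x y) (x / M + β * η) := by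
  have hA : HasSum (fun j => poissonWeight (x / (M * (β * η))) j * (((j + 1)! : ℝ) / j !))
      (x / (M * (β * η)) + 1) := by
    have := (hasSum_descFactorial_mul_poissonWeight (x / (M * (β * η))) 1).add
      (hasSum_descFactorial_mul_poissonWeight (x / (M * (β * η))) 0)
    convert! this using 1
    · ext j
      have : (j ! : ℝ) ≠ 0 := by positivity
      rw [Nat.factorial_succ]
      push_cast [Nat.descFactorial_one, Nat.descFactorial_zero]
      field_simp
    · simp
  have := (hasSum_descFactorial_mul_channelLaw (M := M) hN hx 1 hA).2
  simp only [Nat.descFactorial_one] at this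
  convert! this using 1
  have := hN.ne'
  generalize β * η = N at *
  field_simp

/-- The conditional variance of the output. -/
lemma hasSum_sq_mul_channelLaw (hM : (M : ℝ) ≠ 0) (hN : 0 < β * η) (hx : 0 ≤ x) :
    HasSum (fun y : ℕ => channelLaw M β η x y * ((y : ℝ) - (x / M + β * η)) ^ 2)
      (x / M * (1 + 2 * (β * η)) + β * η * (1 + β * η)) := by
  set l := x / (M * (β * η)) with hl
  have hA : HasSum (fun j => poissonWeight l j * (((j + 2)! : ℝ) / j !))
      (l ^ 2 + 4 * l + 2) := by
    have := ((hasSum_descFactorial_mul_poissonWeight l 2).add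
      ((hasSum_descFactorial_mul_poissonWeight l 1).mul_left 4)).add
      ((hasSum_descFactorial_mul_poissonWeight l 0).mul_left 2)
    convert! this using 1
    · ext j
      have : (j ! : ℝ) ≠ 0 := by positivity
      rw [Nat.factorial_succ, Nat.factorial_succ, Nat.cast_descFactorial_two]
      push_cast [Nat.descFactorial_one, Nat.descFactorial_zero]
      field_simp
      ring
    · simp
  have h2 := (hasSum_descFactorial_mul_channelLaw (M := M) hN hx 2 hA).2
  have h1 := (hasSum_mul_channelLaw hM hN hx).mul_left (1 - 2 * (x / M + β * η))
  have h0 := (hasSum_channelLaw (M := M) hN hx).mul_left ((x / M + β * η) ^ 2)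
  convert! (h2.add h1).add h0 using 1
  · ext y
    rw [Nat.cast_descFactorial_two]
    ring
  · have : x / M = l * (β * η) := by
      have := hN.ne'
      rw [hl]
      generalize β * η = N at *
      field_simp
    rw [this]
    ring

end Moments

/-- A Poisson law with exponentially distributed parameter is geometric, and a geometric mixture of
negative binomial laws is geometric: an exponential input of mean `E` gives an output that is at
most (in fact equal to) geometric of mean `E / M + β η`. -/
lemma lintegral_exp_mul_channelLaw_le {M : ℕ} {β η E : ℝ} (hM : 0 < (M : ℝ)) (hN : 0 < β * η)
    (hE : 0 < E) (y : ℕ) :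
    ∫⁻ x in Set.Ioi (0 : ℝ), ENNReal.ofReal (1 / E * Real.exp (-x / E) * channelLaw M β η x y) ≤
      ENNReal.ofReal (1 / (1 + (E / M + β * η)) *
        ((E / M + β * η) / (1 + (E / M + β * η))) ^ y) := by
  set N := β * η with hNdef
  set s := M * N with hs
  have hs0 : 0 < s := mul_pos hM hN
  set r := 1 / E + 1 / s with hr
  have hr0 : 0 < r := by positivity
  set ρ := E / (E + s) with hρ
  have hρ0 : 0 < ρ := by positivity
  -- The posterior law of `x` given the Poisson count `j` is a gamma law of shape `j + 1`.
  have hpt : ∀ x ∈ Set.Ioi (0 : ℝ),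
      ENNReal.ofReal (1 / E * Real.exp (-x / E) * channelLaw M β η x y)
      = ∑' j : ℕ, ENNReal.ofReal ((1 - ρ) * ρ ^ j * negBinWeight N j y)
          * ProbabilityTheory.gammaPDF (j + 1) r x := by
    intro x hx
    have hx0 : 0 < x := hx
    have hl : 0 ≤ x / s := by positivity
    have hsum := (hasSum_descFactorial_mul_channelLaw (M := M) (hNdef ▸ hN) hx0.le 0
      (hasSum_poissonWeight_zero _)).1 y
    simp only [Nat.descFactorial_zero, Nat.cast_one, one_mul] at hsum
    rw [channelLaw_eq_tsum, ← tsum_mul_left, ENNReal.ofReal_tsum_of_nonneg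
      (fun j => mul_nonneg (by positivity) (mul_nonneg (poissonWeight_nonneg hl j)
        (negBinWeight_pos hN j y).le)) (hsum.mul_left _)]
    refine tsum_congr fun j => ?_
    have h1ρ : 1 - ρ = s / (E + s) := by rw [hρ]; field_simp; ring
    have hb := (negBinWeight_pos hN j y).le
    rw [ProbabilityTheory.gammaPDF_of_nonneg hx0.le, ← ENNReal.ofReal_mul
      (by rw [h1ρ]; positivity)]
    congr 1
    have e1 : Real.exp (-(r * x)) = Real.exp (-x / E) * Real.exp (-(x / s)) := by
      rw [← Real.exp_add, hr]
      congr 1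
      field_simp
      ring
    have e2 : r ^ ((j : ℝ) + 1) = r ^ (j + 1) := by exact_mod_cast Real.rpow_natCast r (j + 1)
    have e3 : x ^ ((j : ℝ) + 1 - 1) = x ^ j := by simp
    have hrr : r = (E + s) / (E * s) := by rw [hr]; field_simp; ring
    rw [e1, e2, e3, Real.Gamma_nat_eq_factorial, poissonWeight, h1ρ, hrr, hρ]
    simp only [div_pow, mul_pow, pow_succ]
    have : (j ! : ℝ) ≠ 0 := by positivity
    field_simp
  rw [setLIntegral_congr_fun measurableSet_Ioi hpt]
  have hmix : HasSum (fun j : ℕ => (1 - ρ) * ρ ^ j * negBinWeight N j y)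
      (1 / (1 + (E / M + N)) * ((E / M + N) / (1 + (E / M + N))) ^ y) := by
    have hq : ‖ρ / (1 + N)‖ < 1 := by
      rw [Real.norm_of_nonneg (by positivity), hρ, div_div, div_lt_one (by positivity)]
      nlinarith [mul_pos hE hN, mul_pos hs0 hN]
    have h := (hasSum_choose_mul_geometric_of_norm_lt_one y hq).mul_left
      ((1 - ρ) / (1 + N) * (N / (1 + N)) ^ y)
    have h1 : 1 - ρ / (1 + N) = N * (M + E + M * N) / ((E + M * N) * (1 + N)) := by
      rw [hρ, hs]
      field_simp
      ring
    have h2 : 1 - ρ = M * N / (E + M * N) := by rw [hρ, hs]; field_simp; ring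
    have h3 : 1 + (E / M + N) = (M + E + M * N) / M := by field_simp; ring
    have h4 : E / M + N = (E + M * N) / M := by field_simp
    convert! h using 1
    · ext j
      rw [negBinWeight, add_comm y j, Nat.choose_symm_add]
      rw [div_pow ρ, one_div, inv_pow, pow_succ]
      field_simp
    · rw [h1, h2, h3, h4]
      simp only [div_pow, mul_pow, pow_succ]
      field_simp
  have hnn : ∀ j : ℕ, 0 ≤ (1 - ρ) * ρ ^ j * negBinWeight N j y := by
    intro j
    have hb := (negBinWeight_pos hN j y).le
    have : ρ ≤ 1 := by rw [hρ, div_le_one (by positivity)]; linarith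
    have : 0 ≤ 1 - ρ := by linarith
    positivity
  have hgm : ∀ j : ℕ, Measurable (ProbabilityTheory.gammaPDF (j + 1) r) := fun j =>
    (ProbabilityTheory.measurable_gammaPDFReal _ _).ennreal_ofReal
  rw [lintegral_tsum fun j => ((hgm j).const_mul _).aemeasurable, ← hmix.tsum_eq,
    ENNReal.ofReal_tsum_of_nonneg hnn hmix.summable]
  refine ENNReal.tsum_le_tsum fun j => ?_
  rw [lintegral_const_mul _ (hgm j)]
  refine mul_le_of_le_one_right' ((setLIntegral_le_lintegral _ _).trans ?_)
  rw [ProbabilityTheory.lintegral_gammaPDF_eq_one (by positivity) hr0]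

/-! ### A Gaussian subprobability on the integers -/

/-- The geometric mean over the unit interval centred at `y` of the Gaussian density of mean `m` and
variance `v`. -/
def gaussianCell (m v y : ℝ) : ℝ :=
  Real.exp (-(1 / 2 * Real.log (2 * Real.pi * v)) - ((y - m) ^ 2 + 1 / 12) / (2 * v))

/-- Jensen's inequality for the exponential, through the tangent of `exp` at the mean exponent. The
summand `1 / 12` in `gaussianCell` is the variance of the uniform law on the interval. -/
lemma gaussianCell_le_integral (m : ℝ) {v : NNReal} (hv : v ≠ 0) (y : ℝ) :
    gaussianCell m v y ≤
      ∫ u in (y - 1 / 2)..(y + 1 / 2), ProbabilityTheory.gaussianPDFReal m v u := by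
  have hv0 : 0 < (v : ℝ) := by positivity
  set K := ((y - m) ^ 2 + 1 / 12) / (2 * (v : ℝ)) with hK
  have hpt : ∀ u, gaussianCell m v y * ((1 + K) - (u - m) ^ 2 / (2 * v)) ≤
      ProbabilityTheory.gaussianPDFReal m v u := by
    intro u
    have e : ProbabilityTheory.gaussianPDFReal m v u =
        gaussianCell m v y * Real.exp (K - (u - m) ^ 2 / (2 * v)) := by
      have h2 : 0 < 2 * Real.pi * (v : ℝ) := by positivity
      rw [gaussianCell, ProbabilityTheory.gaussianPDFReal, ← Real.exp_add, ← hK]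
      rw [show -(1 / 2 * Real.log (2 * Real.pi * v)) - K + (K - (u - m) ^ 2 / (2 * v))
        = -(1 / 2 * Real.log (2 * Real.pi * v)) + -(u - m) ^ 2 / (2 * v) by ring,
        Real.exp_add, Real.exp_neg, mul_comm (1 / 2 : ℝ), Real.exp_mul, Real.exp_log h2,
        Real.sqrt_eq_rpow]
    rw [e]
    refine mul_le_mul_of_nonneg_left ?_ (Real.exp_pos _).le
    linarith [Real.add_one_le_exp (K - (u - m) ^ 2 / (2 * v))]
  have hI : ∫ u in (y - 1 / 2)..(y + 1 / 2), gaussianCell m v y *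
      ((1 + K) - (u - m) ^ 2 / (2 * v)) = gaussianCell m v y := by
    rw [intervalIntegral.integral_const_mul, intervalIntegral.integral_sub
      intervalIntegrable_const (Continuous.intervalIntegrable (by fun_prop) _ _),
      intervalIntegral.integral_div,
      intervalIntegral.integral_comp_sub_right (fun u => u ^ 2), integral_pow]
    rw [intervalIntegral.integral_const, hK, smul_eq_mul]
    refine mul_right_eq_self₀.2 (Or.inl ?_)
    push_cast
    field_simp
    ring
  rw [← hI]
  exact intervalIntegral.integral_mono_on (by linarith)
    (Continuous.intervalIntegrable (by fun_prop) _ _)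
    (ProbabilityTheory.integrable_gaussianPDFReal m v).intervalIntegrable fun u _ => hpt u

lemma tsum_gaussianCell_le_one (m : ℝ) {v : ℝ} (hv : 0 < v) :
    ∑' y : ℕ, ENNReal.ofReal (gaussianCell m v y) ≤ 1 := by
  lift v to NNReal using hv.le
  have hv0 : v ≠ 0 := by
    rintro rfl
    simp at hv
  set I : ℕ → Set ℝ := fun y => Set.Ioc ((y : ℝ) - 1 / 2) (y + 1 / 2) with hI
  have hle : ∀ y : ℕ, ENNReal.ofReal (gaussianCell m v y) ≤
      ∫⁻ u in I y, ProbabilityTheory.gaussianPDF m v u := by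
    intro y
    refine (ENNReal.ofReal_le_ofReal (gaussianCell_le_integral m hv0 y)).trans ?_
    rw [intervalIntegral.integral_of_le (by linarith), ofReal_integral_eq_lintegral_ofReal
      (ProbabilityTheory.integrable_gaussianPDFReal m v).integrableOn
      (Filter.Eventually.of_forall fun u => ProbabilityTheory.gaussianPDFReal_nonneg m v u)]
    rfl
  have hdisj : Pairwise (Function.onFun Disjoint I) := by
    intro i j hij
    rw [Function.onFun, Set.disjoint_left]
    rintro u ⟨h1, h2⟩ ⟨h3, h4⟩
    have h5 : (i : ℝ) < j + 1 := by linarith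
    have h6 : (j : ℝ) < i + 1 := by linarith
    norm_cast at h5 h6
    omega
  calc ∑' y : ℕ, ENNReal.ofReal (gaussianCell m v y)
      ≤ ∑' y : ℕ, ∫⁻ u in I y, ProbabilityTheory.gaussianPDF m v u := ENNReal.tsum_le_tsum hle
    _ = ∫⁻ u in ⋃ y, I y, ProbabilityTheory.gaussianPDF m v u :=
        (lintegral_iUnion (fun _ => measurableSet_Ioc) hdisj _).symm
    _ ≤ ∫⁻ u, ProbabilityTheory.gaussianPDF m v u := setLIntegral_le_lintegral _ _
    _ = 1 := ProbabilityTheory.lintegral_gaussianPDF_eq_one m hv0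

/-! ### The gamma input law -/

section Gamma

variable {a r : ℝ}

open ProbabilityTheory

lemma ae_pos_gammaMeasure (a r : ℝ) : ∀ᵐ x ∂(gammaMeasure a r), 0 < x := by
  rw [ae_iff]
  simp only [not_lt]
  change gammaMeasure a r (Set.Iic 0) = 0
  rw [gammaMeasure, withDensity_apply _ measurableSet_Iic, ← restrict_Iio_eq_restrict_Iic]
  exact lintegral_gammaPDF_of_nonpos le_rfl

/-- The density may be restricted to the positive half-line, where it has its closed form. -/
lemma lintegral_gammaMeasure (a r : ℝ) {f : ℝ → ℝ≥0∞} (hf : Measurable f) :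
    ∫⁻ x, f x ∂(gammaMeasure a r) = ∫⁻ x in Set.Ioi 0, gammaPDF a r x * f x := by
  have hm : Measurable (gammaPDF a r) := (measurable_gammaPDFReal a r).ennreal_ofReal
  rw [← Measure.restrict_eq_self_of_ae_mem (s := Set.Ioi 0) (ae_pos_gammaMeasure a r)]
  rw [gammaMeasure, setLIntegral_withDensity_eq_setLIntegral_mul _ hm hf measurableSet_Ioi]
  rfl

lemma lintegral_id_gammaMeasure (ha : 0 < a) (hr : 0 < r) :
    ∫⁻ x, ENNReal.ofReal x ∂(gammaMeasure a r) = ENNReal.ofReal (a / r) := by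
  rw [lintegral_gammaMeasure a r ENNReal.measurable_ofReal]
  have h : ∀ x ∈ Set.Ioi (0 : ℝ), gammaPDF a r x * ENNReal.ofReal x =
      ENNReal.ofReal (a / r) * gammaPDF (a + 1) r x := by
    intro x hx
    have hx0 : 0 < x := hx
    have hg : 0 < Real.Gamma a := Real.Gamma_pos_of_pos ha
    rw [gammaPDF_of_nonneg hx0.le, gammaPDF_of_nonneg hx0.le,
      ← ENNReal.ofReal_mul (by positivity), ← ENNReal.ofReal_mul (by positivity),
      Real.Gamma_add_one ha.ne', Real.rpow_add_one hr.ne', add_sub_cancel_right,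
      Real.rpow_sub_one hx0.ne']
    congr 1
    field_simp
  have hm : Measurable (gammaPDF (a + 1) r) := (measurable_gammaPDFReal _ r).ennreal_ofReal
  rw [setLIntegral_congr_fun measurableSet_Ioi h, lintegral_const_mul _ hm]
  have : ∫⁻ x in Set.Ioi (0 : ℝ), gammaPDF (a + 1) r x = ∫⁻ x, gammaPDF (a + 1) r x := by
    have h := lintegral_add_compl (μ := volume) (gammaPDF (a + 1) r)
      (measurableSet_Ioi (a := (0 : ℝ)))
    rwa [Set.compl_Ioi, ← restrict_Iio_eq_restrict_Iic, lintegral_gammaPDF_of_nonpos le_rfl,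
      add_zero] at h
  rw [this, lintegral_gammaPDF_eq_one (by positivity) hr, mul_one]

lemma integrable_id_gammaMeasure (ha : 0 < a) (hr : 0 < r) :
    Integrable (fun x => x) (gammaMeasure a r) := by
  rw [← lintegral_ofReal_ne_top_iff_integrable measurable_id'.aestronglyMeasurable
    ((ae_pos_gammaMeasure a r).mono fun x hx => hx.le), lintegral_id_gammaMeasure ha hr]
  exact ENNReal.ofReal_ne_top

lemma integral_id_gammaMeasure (ha : 0 < a) (hr : 0 < r) :
    ∫ x, x ∂(gammaMeasure a r) = a / r := by
  rw [integral_eq_lintegral_of_nonneg_ae ((ae_pos_gammaMeasure a r).mono fun x hx => hx.le)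
    measurable_id'.aestronglyMeasurable, lintegral_id_gammaMeasure ha hr,
    ENNReal.toReal_ofReal (by positivity)]

lemma gammaPDFReal_half {E x : ℝ} (hE : 0 < E) (hx : 0 < x) :
    gammaPDFReal (1 / 2) (1 / (2 * E)) x =
      Real.exp (-x / (2 * E)) / Real.sqrt (2 * Real.pi * E * x) := by
  have e : (1 / 2 - 1 : ℝ) = -(1 / 2) := by norm_num
  rw [gammaPDFReal, if_pos hx.le, Real.Gamma_one_half_eq, e, Real.rpow_neg hx.le,
    ← Real.sqrt_eq_rpow, ← Real.sqrt_eq_rpow, mul_right_comm 2, Real.sqrt_mul (by positivity),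
    mul_right_comm, Real.sqrt_mul (by positivity), Real.sqrt_div zero_le_one, Real.sqrt_one]
  rw [show -(1 / (2 * E) * x) = -x / (2 * E) by ring]
  have : 0 < √(2 * E) := by positivity
  have : 0 < √Real.pi := by positivity
  have : 0 < √x := by positivity
  field_simp

open Filter Topology in
/-- With the antiderivative `√x log (1 + c / x) + 2 √c arctan √(x / c)`. -/
lemma integral_log_one_add_div {c : ℝ} (hc : 0 < c) :
    IntegrableOn (fun x => Real.log (1 + c / x) / (2 * √x)) (Set.Ioi 0) ∧
      ∫ x in Set.Ioi 0, Real.log (1 + c / x) / (2 * √x) = Real.pi * √c := by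
  set G : ℝ → ℝ := fun x => √x * Real.log (1 + c / x) + 2 * √c * Real.arctan (√x / √c) with hG
  have hsc : 0 < √c := Real.sqrt_pos.2 hc
  have hG0 : G 0 = 0 := by simp [hG]
  have hderiv : ∀ x ∈ Set.Ioi (0 : ℝ), HasDerivAt G (Real.log (1 + c / x) / (2 * √x)) x := by
    intro x hx
    have hx0 : 0 < x := hx
    have hsx : 0 < √x := Real.sqrt_pos.2 hx0
    have h1 : HasDerivAt (fun x : ℝ => √x) (1 / (2 * √x)) x := Real.hasDerivAt_sqrt hx0.ne'
    have h2 : HasDerivAt (fun x : ℝ => 1 + c / x) (c * (-(x ^ 2)⁻¹)) x := by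
      simpa [div_eq_mul_inv] using ((hasDerivAt_inv hx0.ne').const_mul c).const_add 1
    have h3 := h1.mul (h2.log (by positivity))
    have h4 := ((h1.div_const (√c)).arctan).const_mul (2 * √c)
    refine (h3.add h4).congr_deriv ?_
    rw [div_pow, Real.sq_sqrt hx0.le, Real.sq_sqrt hc.le]
    have e : x = √x * √x := (Real.mul_self_sqrt hx0.le).symm
    have e' : c = √c * √c := (Real.mul_self_sqrt hc.le).symm
    have : x + c ≠ 0 := by positivity
    have : c + x ≠ 0 := by positivity
    generalize Real.log (1 + c / x) = L
    field_simp
    rw [Real.sq_sqrt hx0.le]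
    ring
  have hnn : ∀ x ∈ Set.Ioi (0 : ℝ), 0 ≤ Real.log (1 + c / x) / (2 * √x) := by
    intro x hx
    have hx0 : 0 < x := hx
    have : 0 ≤ Real.log (1 + c / x) := Real.log_nonneg (by
      have : 0 < c / x := by positivity
      linarith)
    positivity
  have hcont : ContinuousWithinAt G (Set.Ici 0) 0 := by
    rw [← continuousWithinAt_Ioi_iff_Ici, ContinuousWithinAt, hG0]
    have hs : Tendsto (fun x : ℝ => √x) (𝓝[>] 0) (𝓝 0) := by
      have := Real.continuous_sqrt.tendsto 0
      rw [Real.sqrt_zero] at this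
      exact this.mono_left nhdsWithin_le_nhds
    have hl : Tendsto (fun x : ℝ => Real.log (x + c)) (𝓝[>] 0) (𝓝 (Real.log c)) := by
      have : ContinuousAt (fun x : ℝ => Real.log (x + c)) 0 :=
        ContinuousAt.log (by fun_prop) (by simpa using hc.ne')
      have := this.tendsto
      rw [zero_add] at this
      exact this.mono_left nhdsWithin_le_nhds
    have hlx : Tendsto (fun x : ℝ => Real.log x * √x) (𝓝[>] 0) (𝓝 0) := by
      simpa only [Real.sqrt_eq_rpow] using
        tendsto_log_mul_rpow_nhdsGT_zero (r := 1 / 2) (by norm_num)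
    have ha : Tendsto (fun x : ℝ => Real.arctan (√x / √c)) (𝓝[>] 0) (𝓝 0) := by
      have h := (Real.continuous_arctan.tendsto (0 / √c)).comp (hs.div_const (√c))
      rwa [zero_div, Real.arctan_zero] at h
    have := ((hs.mul hl).sub hlx).add (ha.const_mul (2 * √c))
    simp only [zero_mul, sub_zero, mul_zero, add_zero] at this
    refine this.congr' ?_
    filter_upwards [self_mem_nhdsWithin] with x hx
    have hx0 : 0 < x := hx
    rw [hG]
    simp only
    rw [show 1 + c / x = (x + c) / x by field_simp, Real.log_div (by positivity) hx0.ne']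
    ring
  have htop : Tendsto G atTop (𝓝 (Real.pi * √c)) := by
    have h1 : Tendsto (fun x : ℝ => √x * Real.log (1 + c / x)) atTop (𝓝 0) := by
      refine tendsto_of_tendsto_of_tendsto_of_le_of_le' tendsto_const_nhds
        ((tendsto_const_nhds (x := c)).div_atTop Real.tendsto_sqrt_atTop) ?_ ?_
      · filter_upwards [eventually_gt_atTop 0] with x hx0
        have : 0 ≤ Real.log (1 + c / x) := Real.log_nonneg (by
          have : 0 < c / x := by positivity
          linarith)
        positivity
      · filter_upwards [eventually_gt_atTop 0] with x hx0
        have hcx : 0 < c / x := by positivity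
        have hl := Real.log_le_sub_one_of_pos (show 0 < 1 + c / x by positivity)
        calc √x * Real.log (1 + c / x) ≤ √x * (c / x) := by gcongr; linarith
          _ = c / √x := by
            have hsx : 0 < √x := Real.sqrt_pos.2 hx0
            rw [mul_div_assoc', div_eq_div_iff hx0.ne' hsx.ne']
            nlinarith [Real.mul_self_sqrt hx0.le]
    have h2 : Tendsto (fun x : ℝ => Real.arctan (√x / √c)) atTop (𝓝 (Real.pi / 2)) :=
      (Real.tendsto_arctan_atTop.mono_right nhdsWithin_le_nhds).comp
        (Real.tendsto_sqrt_atTop.atTop_div_const hsc)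
    convert! h1.add (h2.const_mul (2 * √c)) using 2
    ring
  refine ⟨integrableOn_Ioi_deriv_of_nonneg hcont hderiv hnn htop, ?_⟩
  rw [integral_Ioi_of_hasDerivAt_of_nonneg hcont hderiv hnn htop, hG0, sub_zero]

/-- Bounding the factor `exp (-x / (2 * E))` of the density by one leaves an explicit integral. -/
lemma integral_log_gammaMeasure_le {E c : ℝ} (hE : 0 < E) (hc : 0 < c) :
    Integrable (fun x => 1 / 2 * Real.log (1 + c / x)) (gammaMeasure (1 / 2) (1 / (2 * E))) ∧
      ∫ x, 1 / 2 * Real.log (1 + c / x) ∂(gammaMeasure (1 / 2) (1 / (2 * E))) ≤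
        √(Real.pi * c / (2 * E)) := by
  have hm : Measurable fun x : ℝ => 1 / 2 * Real.log (1 + c / x) := by fun_prop
  refine integrable_and_integral_le_of_lintegral_le hm ?_ (Real.sqrt_nonneg _) ?_
  · filter_upwards [ae_pos_gammaMeasure _ _] with x hx0
    have : 0 < c / x := by positivity
    have : 0 ≤ Real.log (1 + c / x) := Real.log_nonneg (by linarith)
    simp only [Pi.zero_apply]
    positivity
  · obtain ⟨hi, hI⟩ := integral_log_one_add_div hc
    rw [lintegral_gammaMeasure _ _ hm.ennreal_ofReal]
    have hle : ∀ x ∈ Set.Ioi (0 : ℝ), gammaPDF (1 / 2) (1 / (2 * E)) x *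
        ENNReal.ofReal (1 / 2 * Real.log (1 + c / x)) ≤
        ENNReal.ofReal (1 / √(2 * Real.pi * E) * (Real.log (1 + c / x) / (2 * √x))) := by
      intro x hx
      have hx0 : 0 < x := hx
      have : 0 < c / x := by positivity
      have hl : 0 ≤ Real.log (1 + c / x) := Real.log_nonneg (by linarith)
      rw [gammaPDF, ← ENNReal.ofReal_mul (gammaPDFReal_nonneg (by norm_num) (by positivity) x),
        gammaPDFReal_half hE hx0, Real.sqrt_mul (by positivity)]
      refine ENNReal.ofReal_le_ofReal ?_
      have h1 : Real.exp (-x / (2 * E)) ≤ 1 := Real.exp_le_one_iff.2 (by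
        rw [neg_div]
        have : 0 < x / (2 * E) := by positivity
        linarith)
      have hs : 0 < √x := Real.sqrt_pos.2 hx0
      have hs2 : 0 < √(2 * Real.pi * E) := by positivity
      calc _ ≤ 1 / (√(2 * Real.pi * E) * √x) * (1 / 2 * Real.log (1 + c / x)) := by gcongr
        _ = _ := by field_simp
    refine (setLIntegral_mono' measurableSet_Ioi hle).trans ?_
    rw [← ofReal_integral_eq_lintegral_ofReal (hi.const_mul _), integral_const_mul, hI]
    · refine ENNReal.ofReal_le_ofReal (le_of_eq ?_)
      rw [show Real.pi * c / (2 * E) = Real.pi ^ 2 * c / (2 * Real.pi * E) by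
        have := Real.pi_pos
        field_simp, Real.sqrt_div (by positivity), Real.sqrt_mul (sq_nonneg Real.pi),
        Real.sqrt_sq Real.pi_pos.le]
      ring
    · filter_upwards [ae_restrict_mem measurableSet_Ioi] with x hx
      have hx0 : 0 < x := hx
      have : 0 < c / x := by positivity
      have hl : 0 ≤ Real.log (1 + c / x) := Real.log_nonneg (by linarith)
      simp only [Pi.zero_apply]
      positivity

end Gamma

/-! ### The lower bound on capacity -/

open ProbabilityTheory in
/-- The bound holds for the mutual information achieved by the gamma input of shape `1 / 2` and mean
`ℰ`. The comparison density `h` is the density of the exponential law of mean `ℰ` relative to this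
input law. -/
lemma ofReal_le_mutualInfo_gammaMeasure {M : ℕ} (hM : 0 < (M : ℝ)) {β ℰ : ℝ} (hβ : 0 < β)
    (hℰ : 0 < ℰ) :
    ENNReal.ofReal (1 / 2 * Real.log ℰ
        - Real.sqrt ((M : ℝ) * Real.pi * (12 * β * ℰ * (β * ℰ + 1) + 1)
            / (24 * ℰ * (2 * β * ℰ + 1)))
        - 1
        + (ℰ / (M : ℝ) + β * ℰ) * Real.log (1 + 1 / (ℰ / (M : ℝ) + β * ℰ))
        + Real.log (1 / (M : ℝ) + (1 + β * ℰ) / ℰ)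
        - 1 / 2 * Real.log ((2 * β * ℰ + 1) / (M : ℝ))) ≤
      mutualInfo (channelJoint (gammaMeasure (1 / 2) (1 / (2 * ℰ))) (channelLaw M β ℰ)) := by
  have hQ1 : IsProbabilityMeasure (gammaMeasure (1 / 2) (1 / (2 * ℰ))) :=
    isProbabilityMeasure_gammaMeasure (by norm_num) (by positivity)
  have hpos := ae_pos_gammaMeasure (1 / 2) (1 / (2 * ℰ))
  have hmean : ∫ x, x ∂(gammaMeasure (1 / 2) (1 / (2 * ℰ))) = ℰ := by
    rw [integral_id_gammaMeasure (by norm_num) (by positivity)]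
    field_simp
  have hidi := integrable_id_gammaMeasure (a := 1 / 2) (r := 1 / (2 * ℰ)) (by norm_num)
    (by positivity)
  have hwhR : ∀ y, ∫⁻ x, ENNReal.ofReal (1 / ℰ * Real.exp (-x / (2 * ℰ)) *
      √(2 * Real.pi * ℰ * x) * channelLaw M β ℰ x y) ∂(gammaMeasure (1 / 2) (1 / (2 * ℰ))) ≤
      ENNReal.ofReal (1 / (1 + (ℰ / M + β * ℰ)) *
        ((ℰ / M + β * ℰ) / (1 + (ℰ / M + β * ℰ))) ^ y) := by
    intro y
    have hm := measurable_channelLaw M β ℰ y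
    rw [lintegral_gammaMeasure _ _ (by fun_prop)]
    refine le_trans (le_of_eq ?_) (lintegral_exp_mul_channelLaw_le hM (mul_pos hβ hℰ) hℰ y)
    refine setLIntegral_congr_fun measurableSet_Ioi fun x hx => ?_
    have hx0 : 0 < x := hx
    have hs : 0 < √(2 * Real.pi * ℰ * x) := by positivity
    rw [gammaPDF, ← ENNReal.ofReal_mul (gammaPDFReal_nonneg (by norm_num) (by positivity) x),
      gammaPDFReal_half hℰ hx0]
    congr 1
    have e : Real.exp (-x / ℰ) = Real.exp (-x / (2 * ℰ)) * Real.exp (-x / (2 * ℰ)) := by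
      rw [← Real.exp_add]
      congr 1
      ring
    rw [e]
    field_simp
  set Q := gammaMeasure (1 / 2) (1 / (2 * ℰ)) with hQ
  set N := β * ℰ with hN
  have hN0 : 0 < N := mul_pos hβ hℰ
  set μ := ℰ / M + N with hμ
  have hμ0 : 0 < μ := by positivity
  -- Conditional mean of the output, and conditional variance increased by that of the uniform law
  -- on an interval of length one.
  set m : ℝ → ℝ := fun x => x / M + N with hm
  set v : ℝ → ℝ := fun x => x / M * (1 + 2 * N) + N * (1 + N) + 1 / 12 with hv
  set a : ℝ := M * (N * (1 + N) + 1 / 12) / (1 + 2 * N) with ha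
  have ha0 : 0 < a := by positivity
  have hv0 : ∀ x, 0 < x → 0 < v x := fun x hx => by simp only [hv]; positivity
  have hva : ∀ x, 0 < x → v x = (2 * N + 1) / M * (x * (1 + a / x)) := by
    intro x hx
    simp only [hv, ha]
    field_simp
    ring
  have hWm : ∀ y, Measurable fun x => channelLaw M β ℰ x y := measurable_channelLaw M β ℰ
  have hW0 : ∀ᵐ x ∂Q, ∀ y, 0 < channelLaw M β ℰ x y :=
    hpos.mono fun x hx => channelLaw_pos hN0 hx.le
  have hW1 : ∀ᵐ x ∂Q, HasSum (channelLaw M β ℰ x) 1 :=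
    hpos.mono fun x hx => hasSum_channelLaw hN0 hx.le
  set P := channelJoint Q (channelLaw M β ℰ) with hP
  have hfst : P.map Prod.fst = Q := map_fst_channelJoint hWm hW0 hW1
  -- Integrals against the joint law.
  set K : ℝ → ℝ := fun x => 1 / (2 * v x) * (v x - 1 / 12) with hK
  have hKi : Integrable K Q := by
    refine Integrable.of_bound (C := 1) (Measurable.aestronglyMeasurable (by fun_prop)) ?_
    filter_upwards [hpos] with x hx
    have h1 := hv0 x hx
    have h2 : 1 / 12 < v x := by
      simp only [hv]
      have : 0 < x / M * (1 + 2 * N) + N * (1 + N) := by positivity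
      linarith
    have h3 : 0 ≤ v x - 1 / 12 := by linarith
    rw [Real.norm_of_nonneg (by simp only [hK]; positivity)]
    simp only [hK]
    rw [one_div_mul_eq_div, div_le_one (by positivity)]
    linarith
  obtain ⟨hk1, hk2⟩ := integral_channelJoint_of_nonneg (Q := Q) hWm hW0
    (k := fun x y => 1 / (2 * v x) * ((y : ℝ) - m x) ^ 2) (fun y => by fun_prop)
    (hpos.mono fun x hx y => by have := hv0 x hx; positivity) hKi (by
      filter_upwards [hpos] with x hx
      have := (hasSum_sq_mul_channelLaw hM.ne' hN0 hx.le).mul_left (1 / (2 * v x))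
      convert! this using 1
      · ext y
        exact mul_left_comm _ _ _
      · simp only [hK, hv]
        ring)
  obtain ⟨hy1, hy2⟩ := integral_channelJoint_of_nonneg (Q := Q) hWm hW0
    (k := fun _ y => (y : ℝ)) (K := m) (fun y => measurable_const)
    (Filter.Eventually.of_forall fun x y => Nat.cast_nonneg y)
    ((hidi.div_const _).add (integrable_const _)) (by
      filter_upwards [hpos] with x hx
      simpa only [mul_comm] using hasSum_mul_channelLaw hM.ne' hN0 hx.le)
  obtain ⟨hl1, hl2⟩ := integral_log_gammaMeasure_le hℰ ha0
  rw [← hQ] at hl1 hl2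
  set C : ℝ := -(1 / 2) * Real.log ℰ - 1 / 2 * Real.log ((2 * N + 1) / M) + Real.log (1 + μ) - 1 / 2
    with hC
  -- The part of the integrand that depends on the input only; the term `-1 / (24 v)` of
  -- `log g` is written as `K - 1 / 2`.
  set ψ : ℝ → ℝ := fun x => C + K x - x / (2 * ℰ) - 1 / 2 * Real.log (1 + a / x) with hψ
  have hψ1 : Integrable (fun x => C + K x) Q := (integrable_const C).add hKi
  have hψ2 : Integrable (fun x => C + K x - x / (2 * ℰ)) Q := hψ1.sub (hidi.div_const _)
  have hψi : Integrable ψ Q := hψ2.sub hl1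
  have hψI : ∫ x, ψ x ∂Q = C + ∫ x, K x ∂Q - 1 / 2 - ∫ x, 1 / 2 * Real.log (1 + a / x) ∂Q := by
    rw [hψ, integral_sub hψ2 hl1, integral_sub hψ1 (hidi.div_const _),
      integral_add (integrable_const C) hKi, integral_div, hmean]
    have : ℰ / (2 * ℰ) = 1 / 2 := by field_simp
    simp [this]
  have hψP : Integrable (fun p : ℝ × ℕ => ψ p.1) P := by
    rw [← hfst] at hψi
    exact hψi.comp_measurable measurable_fst
  have hψPI : ∫ p, ψ p.1 ∂P = ∫ x, ψ x ∂Q := by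
    rw [← hfst, integral_map measurable_fst.aemeasurable (hfst.symm ▸ hψi.1)]
  have hmI : ∫ x, m x ∂Q = μ := by
    rw [hm, integral_add (hidi.div_const _) (integrable_const _), integral_div, hmean]
    simp [hμ]
  -- After the terms `log x` cancel, the integrand splits into integrable pieces.
  have hfae : (fun p : ℝ × ℕ => Real.log (gaussianCell (m p.1) (v p.1) p.2)
        + Real.log (1 / ℰ * Real.exp (-p.1 / (2 * ℰ)) * √(2 * Real.pi * ℰ * p.1))
        - Real.log (1 / (1 + μ) * (μ / (1 + μ)) ^ p.2)) =ᵐ[P]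
      fun p => ψ p.1 - 1 / (2 * v p.1) * ((p.2 : ℝ) - m p.1) ^ 2
        + Real.log (1 + 1 / μ) * (p.2 : ℝ) := by
    filter_upwards [ae_channelJoint (W := channelLaw M β ℰ) hpos] with p hx
    obtain ⟨x, y⟩ := p
    simp only at hx ⊢
    have hvx := hv0 x hx
    have h1 : 0 < 1 + a / x := by positivity
    have e1 : Real.log (2 * Real.pi * v x) = Real.log (2 * Real.pi)
        + (Real.log ((2 * N + 1) / M) + (Real.log x + Real.log (1 + a / x))) := by
      rw [Real.log_mul (by positivity) hvx.ne', hva x hx,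
        Real.log_mul (x := (2 * N + 1) / M) (by positivity) (mul_pos hx h1).ne',
        Real.log_mul hx.ne' h1.ne']
    have e2 : Real.log (√(2 * Real.pi * ℰ * x)) =
        1 / 2 * (Real.log (2 * Real.pi) + Real.log ℰ + Real.log x) := by
      rw [Real.log_sqrt (by positivity), Real.log_mul (by positivity) hx.ne',
        Real.log_mul (by positivity) hℰ.ne']
      ring
    have e3 : Real.log (1 + 1 / μ) = Real.log (1 + μ) - Real.log μ := by
      rw [← Real.log_div (by positivity) hμ0.ne']
      congr 1
      field_simp
      ring
    have e4 : K x = 1 / 2 - 1 / 12 / (2 * v x) := by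
      simp only [hK]
      field_simp
    rw [gaussianCell, Real.log_exp, e1,
      Real.log_mul (x := 1 / ℰ * Real.exp (-x / (2 * ℰ))) (by positivity) (by positivity),
      Real.log_mul (by positivity) (Real.exp_pos _).ne', Real.log_exp, e2,
      Real.log_mul (x := 1 / (1 + μ)) (by positivity) (by positivity), Real.log_pow,
      Real.log_div hμ0.ne' (by positivity), one_div ℰ, one_div (1 + μ), Real.log_inv, Real.log_inv]
    simp only [hψ, hC]
    rw [e3, e4]
    ring
  have hi1 := hψP.sub hk1
  have hi2 := hi1.add (hy1.const_mul (Real.log (1 + 1 / μ)))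
  have key := ofReal_integral_le_mutualInfo (Q := Q) hWm hW0 hW1
    (g := fun x y => gaussianCell (m x) (v x) y)
    (fun y => by unfold gaussianCell; fun_prop)
    (Filter.Eventually.of_forall fun x y => Real.exp_pos _)
    (hpos.mono fun x hx => tsum_gaussianCell_le_one (m x) (hv0 x hx))
    (h := fun x => 1 / ℰ * Real.exp (-x / (2 * ℰ)) * √(2 * Real.pi * ℰ * x))
    (by fun_prop) (hpos.mono fun x hx => by positivity)
    (R := fun y => 1 / (1 + μ) * (μ / (1 + μ)) ^ y) (fun y => by positivity) hwhR
    (hi2.congr hfae.symm)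
  refine le_trans (ENNReal.ofReal_le_ofReal ?_) key
  rw [integral_congr_ae hfae]
  have hI : ∫ p, (ψ p.1 - 1 / (2 * v p.1) * ((p.2 : ℝ) - m p.1) ^ 2
        + Real.log (1 + 1 / μ) * (p.2 : ℝ)) ∂P
      = ∫ x, ψ x ∂Q - ∫ x, K x ∂Q + Real.log (1 + 1 / μ) * μ := by
    refine (integral_add' hi1 (hy1.const_mul (Real.log (1 + 1 / μ)))).trans ?_
    rw [integral_sub' hψP hk1, integral_const_mul, hψPI, hk2, hy2, hmI]
  rw [hI, hψI]
  have s1 : Real.pi * a / (2 * ℰ) = (M : ℝ) * Real.pi * (12 * β * ℰ * (N + 1) + 1)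
      / (24 * ℰ * (2 * β * ℰ + 1)) := by
    rw [ha, mul_assoc 12 β, mul_assoc 2 β, ← hN]
    field_simp
    ring
  have s2 : Real.log (1 / (M : ℝ) + (1 + N) / ℰ) = Real.log (1 + μ) - Real.log ℰ := by
    rw [← Real.log_div (by positivity) hℰ.ne']
    congr 1
    rw [hμ]
    field_simp
    ring
  rw [s1] at hl2
  rw [s2, mul_assoc 2 β, ← hN, hC]
  rw [mul_assoc 2 β, ← hN] at hl2
  linarith

lemma noiseFactor_pos {M N₀ : ℕ} (hM : 2 ≤ M) (hN₀ : 1 ≤ N₀) : 0 < noiseFactor M N₀ := by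
  have h1 : (2 : ℝ) ≤ M := by exact_mod_cast hM
  have h2 : (1 : ℝ) ≤ N₀ := by exact_mod_cast hN₀
  exact div_pos (by linarith) (by positivity)

open ProbabilityTheory in
lemma avgPower_gammaMeasure {ℰ : ℝ} (hℰ : 0 < ℰ) :
    avgPower (gammaMeasure (1 / 2) (1 / (2 * ℰ))) = ℰ := by
  rw [avgPower, integral_id_gammaMeasure (by norm_num) (by positivity)]
  field_simp

open ProbabilityTheory in
lemma isAdmissible_gammaMeasure {ℰ : ℝ} (hℰ : 0 < ℰ) :
    IsAdmissible ℰ (gammaMeasure (1 / 2) (1 / (2 * ℰ))) where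
  isProbabilityMeasure := isProbabilityMeasure_gammaMeasure (by norm_num) (by positivity)
  nonneg := (ae_pos_gammaMeasure _ _).mono fun _ hx => hx.le
  integrable := integrable_id_gammaMeasure (by norm_num) (by positivity)
  avgPower_le := (avgPower_gammaMeasure hℰ).le

end CoherentCDMA

end

theorem theorem5 (M N₀ : ℕ) (hM : 2 ≤ M) (hN₀ : 1 ≤ N₀) (β : ℝ)
    (hβ : β = CoherentCDMA.noiseFactor M N₀) (ℰ : ℝ) (hℰ : 0 < ℰ) :
    ((1 / 2 * Real.log ℰ
        - Real.sqrt ((M : ℝ) * Real.pi * (12 * β * ℰ * (β * ℰ + 1) + 1)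
            / (24 * ℰ * (2 * β * ℰ + 1)))
        - 1
        + (ℰ / (M : ℝ) + β * ℰ) * Real.log (1 + 1 / (ℰ / (M : ℝ) + β * ℰ))
        + Real.log (1 / (M : ℝ) + (1 + β * ℰ) / ℰ)
        - 1 / 2 * Real.log ((2 * β * ℰ + 1) / (M : ℝ)) : ℝ) : EReal)
      ≤ ((CoherentCDMA.capacity M β ℰ : ENNReal) : EReal) := by
  have hβ0 : 0 < β := hβ ▸ CoherentCDMA.noiseFactor_pos hM hN₀
  have hM0 : 0 < (M : ℝ) := by
    have : 0 < M := by omega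
    exact_mod_cast this
  have h := CoherentCDMA.ofReal_le_mutualInfo_gammaMeasure hM0 hβ0 hℰ
  have hj : CoherentCDMA.jointLaw M β (ProbabilityTheory.gammaMeasure (1 / 2) (1 / (2 * ℰ))) =
      CoherentCDMA.channelJoint (ProbabilityTheory.gammaMeasure (1 / 2) (1 / (2 * ℰ)))
        (CoherentCDMA.channelLaw M β ℰ) := by
    rw [CoherentCDMA.jointLaw, CoherentCDMA.avgPower_gammaMeasure hℰ]
    rfl
  rw [← hj] at h
  have hcap : CoherentCDMA.mutualInfo (CoherentCDMA.jointLaw M β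
      (ProbabilityTheory.gammaMeasure (1 / 2) (1 / (2 * ℰ)))) ≤ CoherentCDMA.capacity M β ℰ :=
    le_iSup₂_of_le _ (CoherentCDMA.isAdmissible_gammaMeasure hℰ) le_rfl
  have h' := EReal.coe_ennreal_le_coe_ennreal_iff.2 (h.trans hcap)
  rw [EReal.coe_ennreal_ofReal] at h'
  exact (EReal.coe_le_coe_iff.2 (le_max_left _ _)).trans h'
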